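/- **Theorem 1.2.** Let $M$ be a connected smooth ($C^\infty$) finite-dimensional manifold (Hausdorff, without boundary), and let the circle group $S^1$ act on $M$ by a smooth action $\Phi : S^1 \times M \to M$, $(g,x) \mapsto g\cdot x$. Let $F = \{x \in M : g\cdot x = x \text{ for all } g \in S^1\}$ be the fixed-point set. Let $K = \{g \in S^1 : g\cdot x = x \text{ for all } x \in M\}$ be the ineffectivity kernel, i.e. the kernel of the induced homomorphism $S^1 \to \operatorname{Diff} M$. Let $$Z_{\mathrm{id}} = \{\alpha \in C^\infty(M, S^1) : \alpha(x)\cdot x = x \text{ for all } x \in M\},$$ a subgroup of the group $C^\infty(M, S^1)$ under pointwise multiplication. Suppose that the action is non-trivial, i.e. $g\cdot x \neq x$ for some $g \in S^1$ and $x \in M$. Then: 1. $F$ has empty interior in $M$. 2. $Z_{\mathrm{id}}$ consists exactly of the constant mappings $M \to S^1$ whose value lies in $K$. 3. Consequently, the map sending $\alpha \in Z_{\mathrm{id}}$ to its constant value is a group isomorphism $Z_{\mathrm{id}} \cong K$, and both groups are finite cyclic. -/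

import Mathlib

open scoped Manifold ContDiff

noncomputable section

namespace LieAction

variable {EG : Type*} [NormedAddCommGroup EG] [NormedSpace ℝ EG]
  {HG : Type*} [TopologicalSpace HG] (J : ModelWithCorners ℝ EG HG)
  {E : Type*} [NormedAddCommGroup E] [NormedSpace ℝ E]
  {H : Type*} [TopologicalSpace H] (I : ModelWithCorners ℝ E H)
  (G : Type*) [TopologicalSpace G] [ChartedSpace HG G] [Group G]
  (M : Type*) [TopologicalSpace M] [ChartedSpace H M]
  [MulAction G M] [ContMDiffSMul J I ∞ G M]

/-- The ineffectivity kernel `K` of a smooth action: the elements of `G` whose image in `Diff M`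
is the identity diffeomorphism. -/
def ineffectivityKernel : Subgroup G where
  carrier := {g | Diffeomorph.smul J I ∞ g = Diffeomorph.refl I M ∞}
  one_mem' := Diffeomorph.ext fun x => one_smul G x
  mul_mem' {a b} ha hb := Diffeomorph.ext fun x => by
    have h1 : ∀ y : M, a • y = y := fun y => congrArg (fun f : M ≃ₘ^∞⟮I, I⟯ M => f y) ha
    have h2 : ∀ y : M, b • y = y := fun y => congrArg (fun f : M ≃ₘ^∞⟮I, I⟯ M => f y) hb
    change (a * b) • x = x
    rw [mul_smul, h2, h1]
  inv_mem' {a} ha := Diffeomorph.ext fun x => by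
    have h1 : ∀ y : M, a • y = y := fun y => congrArg (fun f : M ≃ₘ^∞⟮I, I⟯ M => f y) ha
    change a⁻¹ • x = x
    rw [inv_smul_eq_iff, h1]

theorem mem_ineffectivityKernel_iff (g : G) :
    g ∈ ineffectivityKernel J I G M ↔ ∀ x : M, g • x = x :=
  ⟨fun h x => congrArg (fun f : M ≃ₘ^∞⟮I, I⟯ M => f x) h, fun h => Diffeomorph.ext h⟩

variable {G M} in
/-- The mapping `φ : C^∞(M, G) → C^∞(M, M)`, `φ(α)(x) = α(x) • x`. -/
def sectionMap (α : C^∞⟮I, M; J, G⟯) : C^∞⟮I, M; I, M⟯ :=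
  ⟨fun x => α x • x, α.contMDiff.smul contMDiff_id⟩

variable [LieGroup J ∞ G]

/-- `Z_id = φ⁻¹(id_M)`, as a subgroup of `C^∞(M, G)` with pointwise multiplication. -/
def Zid : Subgroup C^∞⟮I, M; J, G⟯ where
  carrier := {α | sectionMap J I α = ContMDiffMap.id}
  one_mem' := ContMDiffMap.ext fun x => one_smul G x
  mul_mem' {α β} hα hβ := ContMDiffMap.ext fun x => by
    have h1 : α x • x = x := congrArg (fun f : C^∞⟮I, M; I, M⟯ => f x) hα
    have h2 : β x • x = x := congrArg (fun f : C^∞⟮I, M; I, M⟯ => f x) hβ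
    change (α x * β x) • x = x
    rw [mul_smul, h2, h1]
  inv_mem' {α} hα := ContMDiffMap.ext fun x => by
    have h1 : α x • x = x := congrArg (fun f : C^∞⟮I, M; I, M⟯ => f x) hα
    change (α x)⁻¹ • x = x
    rw [inv_smul_eq_iff, h1]

theorem mem_Zid_iff (α : C^∞⟮I, M; J, G⟯) : α ∈ Zid J I G M ↔ ∀ x : M, α x • x = x :=
  ⟨fun h x => congrArg (fun f : C^∞⟮I, M; I, M⟯ => f x) h, fun h => ContMDiffMap.ext h⟩

end LieAction

end

open Filter Topology

/-! If the fixed-point set had interior, each finite-order element of the circle would act as a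
periodic map fixing an open set; such a map is the identity on a connected manifold
(`ContMDiff.eq_self_of_interior_fixedPoints_nonempty`). Elements of finite order are dense, so the
action would be trivial.

Hence non-fixed points are dense. Near each of them the isotropy groups lie in the `m`-th roots of
unity for one `m` (`Circle.exists_pow_eq_one_of_smul_ne`), so a continuous choice of isotropy
elements is locally constant there. Its derivative vanishes on a dense set, hence everywhere, and
connectedness makes it constant. -/

/-- A map with strict derivative the identity at a fixed point, one of whose iterates is the
identity near that point, is itself the identity near that point. -/
theorem HasStrictFDerivAt.eventually_eq_self_of_iterate {E : Type*} [NormedAddCommGroup E]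
    [NormedSpace ℝ E] {g : E → E} {p : E} (hg : HasStrictFDerivAt g (.id ℝ E) p) (hp : g p = p)
    {n : ℕ} (hn : 0 < n) (hiter : ∀ᶠ y in 𝓝 p, g^[n] y = y) : ∀ᶠ y in 𝓝 p, g y = y := by
  -- Periodicity makes the sum of the iterates `g`-invariant, while its strict derivative `n • id`
  -- makes it injective near `p`.
  have hsum : HasStrictFDerivAt (fun y => ∑ k ∈ Finset.range n, g^[k] y)
      (∑ k ∈ Finset.range n, (.id ℝ E : E →L[ℝ] E) ^ k) p :=
    .fun_sum fun k _ => hg.iterate hp k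
  have hid : ∀ k : ℕ, (.id ℝ E : E →L[ℝ] E) ^ k = .id ℝ E := fun k => one_pow k
  have hlim : Tendsto (fun y => (y, g y)) (𝓝 p) (𝓝 (p, p)) := by
    have := hg.continuousAt.tendsto
    rw [hp] at this
    rw [nhds_prod_eq]
    exact tendsto_id.prodMk this
  -- Any constant below `1 ≤ n` would do: the bound becomes `n * ‖y - g y‖ ≤ c * ‖y - g y‖`.
  have hlit := hlim.eventually (hsum.isLittleO.def (c := 1 / 2) (by norm_num))
  filter_upwards [hlit, hiter] with y hy hyn
  have hshift : ∑ k ∈ Finset.range n, g^[k] (g y) = ∑ k ∈ Finset.range n, g^[k] y := by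
    have h1 := Finset.sum_range_succ (fun k => g^[k] y) n
    have h2 := Finset.sum_range_succ' (fun k => g^[k] y) n
    rw [h1] at h2
    simp only [hyn, Function.iterate_zero, id_eq, Function.iterate_succ, Function.comp_apply,
      add_left_inj] at h2
    exact h2.symm
  simp only [hshift, hid, Finset.sum_const, Finset.card_range, sub_self, zero_sub, norm_neg,
    smul_apply, ContinuousLinearMap.id_apply, ← Nat.cast_smul_eq_nsmul ℝ,
    norm_smul, Real.norm_natCast] at hy
  have hn1 : (1 : ℝ) ≤ n := by exact_mod_cast hn
  have h0 : ‖y - g y‖ = 0 := by nlinarith [norm_nonneg (y - g y)]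
  exact (sub_eq_zero.1 (norm_eq_zero.1 h0)).symm

section Manifold

variable {E : Type*} [NormedAddCommGroup E] [NormedSpace ℝ E]
  {M : Type*} [TopologicalSpace M] [ChartedSpace E M]

/-- By continuity the derivative in a chart is still the identity at a limit of interior fixed
points, so periodicity applies there. This makes the interior closed. -/
theorem ContMDiff.eventually_eq_self_of_mem_closure [IsManifold 𝓘(ℝ, E) 1 M] [T2Space M]
    {f : M → M} (hf : ContMDiff 𝓘(ℝ, E) 𝓘(ℝ, E) 1 f) {n : ℕ} (hn : 0 < n)
    (hiter : ∀ y, f^[n] y = y) {x : M} (hx : x ∈ closure (interior (Function.fixedPoints f))) :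
    ∀ᶠ y in 𝓝 x, f y = y := by
  have hclosed : IsClosed (Function.fixedPoints f) := isClosed_fixedPoints hf.continuous
  have hfx : f x = x := closure_minimal interior_subset hclosed hx
  set φ := chartAt E x
  have hxs : x ∈ φ.source := mem_chart_source E x
  set g : E → E := φ ∘ f ∘ φ.symm
  have hgp : g (φ x) = φ x := by simp [g, φ.left_inv hxs, hfx]
  have hgs : ContDiffAt ℝ 1 g (φ x) := by
    have := (contMDiffAt_iff.1 (hf x)).2
    rw [hfx] at this
    simpa [g, φ, contDiffWithinAt_univ] using this
  have hderiv : fderiv ℝ g (φ x) = .id ℝ E := by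
    have hcont : ContinuousAt (fderiv ℝ g) (φ x) := (hgs.fderiv_right (m := 0) le_rfl).continuousAt
    refine (isClosed_singleton (x := ContinuousLinearMap.id ℝ E)).mem_of_frequently_of_tendsto
      ?_ hcont.tendsto
    rw [← φ.map_nhds_eq hxs, frequently_map]
    refine ((mem_closure_iff_frequently.1 hx).and_eventually (φ.open_source.mem_nhds hxs)).mono ?_
    rintro z ⟨hz, hzs⟩
    have hev : g =ᶠ[𝓝 (φ z)] id := by
      rw [← φ.map_nhds_eq hzs]
      change ∀ᶠ w in 𝓝 z, g (φ w) = id (φ w)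
      filter_upwards [mem_interior_iff_mem_nhds.1 hz, φ.open_source.mem_nhds hzs] with w hw hws
      simp [g, φ.left_inv hws, hw.eq]
    exact hev.fderiv_eq.trans fderiv_id
  have hstrict : HasStrictFDerivAt g (.id ℝ E) (φ x) := by
    rw [← hderiv]
    exact hgs.hasStrictFDerivAt one_ne_zero
  have hconj : ∀ k : ℕ, ∀ᶠ y in 𝓝 x, g^[k] (φ y) = φ (f^[k] y) := by
    intro k
    induction k with
    | zero => simp
    | succ k ih =>
      have hk : Tendsto f^[k] (𝓝 x) (𝓝 x) := by
        have := (hf.continuous.iterate k).tendsto x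
        rwa [Function.iterate_fixed hfx] at this
      filter_upwards [ih, hk (φ.open_source.mem_nhds hxs)] with y hy hys
      rw [Function.iterate_succ_apply', Function.iterate_succ_apply', hy]
      simp [g, φ.left_inv hys]
  have hgn : ∀ᶠ y in 𝓝 (φ x), g^[n] y = y := by
    rw [← φ.map_nhds_eq hxs, eventually_map]
    filter_upwards [hconj n] with y hy
    rw [hy, hiter]
  have hfin := hstrict.eventually_eq_self_of_iterate hgp hn hgn
  rw [← φ.map_nhds_eq hxs, eventually_map] at hfin
  have hf1 : Tendsto f (𝓝 x) (𝓝 x) := by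
    have := hf.continuous.tendsto x
    rwa [hfx] at this
  filter_upwards [hfin, φ.open_source.mem_nhds hxs, hf1 (φ.open_source.mem_nhds hxs)] with y h1 h2 h3
  apply φ.injOn h3 h2
  simpa [g, φ.left_inv h2] using h1

/-- A periodic `C^1` self-map of a connected manifold that fixes a nonempty open set pointwise is
the identity. -/
theorem ContMDiff.eq_self_of_interior_fixedPoints_nonempty [IsManifold 𝓘(ℝ, E) 1 M] [T2Space M]
    [PreconnectedSpace M] {f : M → M} (hf : ContMDiff 𝓘(ℝ, E) 𝓘(ℝ, E) 1 f) {n : ℕ} (hn : 0 < n)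
    (hiter : ∀ y, f^[n] y = y) (hne : (interior (Function.fixedPoints f)).Nonempty) (x : M) :
    f x = x := by
  have hclosed : IsClosed (interior (Function.fixedPoints f)) :=
    isClosed_of_closure_subset fun y hy =>
      mem_interior_iff_mem_nhds.2 (hf.eventually_eq_self_of_mem_closure hn hiter hy)
  have huniv := IsClopen.eq_univ ⟨hclosed, isOpen_interior⟩ hne
  exact interior_subset (s := Function.fixedPoints f) (by rw [huniv]; exact Set.mem_univ x)

/-- A `C^1` function that is locally constant near the points of a dense set is locally
constant. -/
theorem ContMDiff.isLocallyConstant_of_dense [IsManifold 𝓘(ℝ, E) 1 M]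
    {F : Type*} [NormedAddCommGroup F] [NormedSpace ℝ F] {f : M → F}
    (hf : ContMDiff 𝓘(ℝ, E) 𝓘(ℝ, F) 1 f) {D : Set M} (hD : Dense D)
    (hconst : ∀ x ∈ D, ∀ᶠ y in 𝓝 x, f y = f x) : IsLocallyConstant f := by
  rw [IsLocallyConstant.iff_eventually_eq]
  intro x
  set φ := chartAt E x
  have hxs : x ∈ φ.source := mem_chart_source E x
  have hxt : φ x ∈ φ.target := φ.map_source hxs
  have hg : ContDiffOn ℝ 1 (f ∘ φ.symm) φ.target := by
    have := hf.comp_contMDiffOn (contMDiffOn_chart_symm (I := 𝓘(ℝ, E)) (n := 1) (x := x))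
    exact contMDiffOn_iff_contDiffOn.1 this
  obtain ⟨r, hr, hball⟩ := Metric.isOpen_iff.1 φ.open_target (φ x) hxt
  -- The derivative is continuous and vanishes at the dense set of chart images of `D`.
  have hzero : Set.EqOn (fderiv ℝ (f ∘ φ.symm)) 0 (Metric.ball (φ x) r) := by
    intro y hy
    have hyt := hball hy
    have hys : φ.symm y ∈ φ.source := φ.map_target hyt
    have hcont : ContinuousAt (fderiv ℝ (f ∘ φ.symm)) y :=
      ((hg.contDiffAt (φ.open_target.mem_nhds hyt)).fderiv_right (m := 0) le_rfl).continuousAt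
    refine (isClosed_singleton (x := (0 : E →L[ℝ] F))).mem_of_frequently_of_tendsto ?_ hcont.tendsto
    rw [← φ.right_inv hyt, ← φ.map_nhds_eq hys, frequently_map]
    refine ((mem_closure_iff_frequently.1 (hD (φ.symm y))).and_eventually
      (φ.open_source.mem_nhds hys)).mono ?_
    rintro z ⟨hz, hzs⟩
    have hev : (f ∘ φ.symm) =ᶠ[𝓝 (φ z)] fun _ => f z := by
      rw [← φ.map_nhds_eq hzs]
      change ∀ᶠ w in 𝓝 z, (f ∘ φ.symm) (φ w) = f z
      filter_upwards [hconst z hz, φ.open_source.mem_nhds hzs] with w hw hws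
      simp [φ.left_inv hws, hw]
    exact hev.fderiv_eq.trans (fderiv_const_apply _)
  filter_upwards [φ.open_source.mem_nhds hxs,
    (φ.continuousAt hxs).preimage_mem_nhds (Metric.ball_mem_nhds _ hr)] with y hys hy
  have := Metric.isOpen_ball.is_const_of_fderiv_eq_zero (convex_ball (φ x) r).isPreconnected
    ((hg.differentiableOn one_ne_zero).mono hball) hzero hy (Metric.mem_ball_self hr)
  simpa [φ.left_inv hys, φ.left_inv hxs] using this

end Manifold

/-! ### Isotropy groups of circle actions -/

section CircleAction

theorem Circle.finite_setOf_pow_eq_one {m : ℕ} (hm : 0 < m) : {z : Circle | z ^ m = 1}.Finite := by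
  classical
  refine Set.Finite.of_finite_image (f := ((↑) : Circle → ℂ)) ?_ Circle.coe_injective.injOn
  refine (Polynomial.nthRoots m (1 : ℂ)).toFinset.finite_toSet.subset ?_
  rintro _ ⟨z, hz, rfl⟩
  have : (z : ℂ) ^ m = 1 := by exact_mod_cast congrArg ((↑) : Circle → ℂ) hz
  simpa [Polynomial.mem_nthRoots hm] using this

variable {M : Type*} [TopologicalSpace M] [MulAction Circle M]

/-- If every element of finite order acts trivially, then the circle acts trivially. -/
theorem Circle.smul_eq_self_of_forall_isOfFinOrder [T2Space M] [ContinuousSMul Circle M]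
    (h : ∀ g : Circle, IsOfFinOrder g → ∀ x : M, g • x = x) (g : Circle) (x : M) : g • x = x := by
  have hclosed : IsClosed {t : ℝ | Circle.exp (2 * Real.pi * t) • x = x} :=
    isClosed_eq (by fun_prop) continuous_const
  have hrat : Set.range ((↑) : ℚ → ℝ) ⊆ {t : ℝ | Circle.exp (2 * Real.pi * t) • x = x} := by
    rintro _ ⟨q, rfl⟩
    refine h _ (isOfFinOrder_iff_pow_eq_one.2 ⟨q.den, q.den_pos, ?_⟩) x
    have hq : (q.den : ℝ) * q = q.num := by exact_mod_cast q.den_mul_eq_num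
    have : Circle.exp (2 * Real.pi * q) ^ q.den = Circle.exp (q.num * (2 * Real.pi)) := by
      rw [← Circle.exp_nsmul, nsmul_eq_mul, ← hq]
      congr 1
      ring
    rw [this, Circle.exp_int_mul_two_pi]
  obtain ⟨t, rfl⟩ := Circle.exp_surjective g
  have hmem : t / (2 * Real.pi) ∈ {t : ℝ | Circle.exp (2 * Real.pi * t) • x = x} :=
    closure_minimal hrat hclosed (Rat.denseRange_cast _)
  rwa [Set.mem_ofPred_eq, mul_div_cancel₀ _ Real.two_pi_pos.ne'] at hmem

/-- Near a point that is not fixed by the circle, the isotropy groups have bounded exponent. -/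
theorem Circle.exists_pow_eq_one_of_smul_ne [T2Space M] [ContinuousSMul Circle M] {g : Circle}
    {x : M} (hg : g • x ≠ x) :
    ∃ m : ℕ, 0 < m ∧ ∀ᶠ y in 𝓝 x, ∀ s : Circle, s • y = y → s ^ m = 1 := by
  obtain ⟨t₀, rfl⟩ := Circle.exp_surjective g
  have hopen : IsOpen {p : ℝ × M | Circle.exp p.1 • p.2 ≠ p.2} :=
    isOpen_ne_fun (by fun_prop) continuous_snd
  obtain ⟨u, hu, v, hv, huv⟩ := mem_nhds_prod_iff.1 (hopen.mem_nhds (x := (t₀, x)) hg)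
  obtain ⟨δ, hδ, hball⟩ := Metric.mem_nhds_iff.1 hu
  obtain ⟨N, hN⟩ := exists_nat_gt (2 * Real.pi / δ)
  have hNpos : 0 < N := by
    have : (0 : ℝ) < N := lt_trans (by positivity) hN
    exact_mod_cast this
  refine ⟨N.factorial, N.factorial_pos, ?_⟩
  filter_upwards [hv] with y hy s hs
  have hmiss : ∀ t : ℝ, |t - t₀| < δ → Circle.exp t • y ≠ y := fun t ht =>
    huv (Set.mk_mem_prod (hball ht) hy)
  -- A nonzero `t` this small has an integer multiple within `|t| / 2` of `t₀`, which would also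
  -- stabilize `y`.
  have hsmall : ∀ t : ℝ, |t| < δ → Circle.exp t • y = y → t = 0 := by
    intro t ht hty
    by_contra ht0
    have hz : ∀ k : ℤ, Circle.exp (k * t) • y = y := fun k => by
      rw [← zsmul_eq_mul, Circle.exp_zsmul]
      exact (MulAction.stabilizer Circle y).zpow_mem (x := Circle.exp t) hty k
    refine hmiss (round (t₀ / t) * t) ?_ (hz _)
    have h1 := abs_sub_round (t₀ / t)
    have h2 : round (t₀ / t) * t - t₀ = -((t₀ / t - round (t₀ / t)) * t) := by
      field_simp
      ring
    rw [h2, abs_neg, abs_mul]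
    nlinarith [abs_pos.2 ht0]
  obtain ⟨t, rfl⟩ := Circle.exp_surjective s
  -- Dirichlet approximation: some `k ≤ N` brings `k * t` within `δ` of a multiple of `2π`, hence
  -- onto it; then `k ∣ N!`.
  obtain ⟨k, hk, hkN, hkle⟩ := Real.exists_nat_abs_mul_sub_round_le (t / (2 * Real.pi)) hNpos
  set j := round ((k : ℝ) * (t / (2 * Real.pi)))
  have hexp : Circle.exp (k * t - j * (2 * Real.pi)) = Circle.exp t ^ k := by
    rw [Circle.exp_sub, Circle.exp_int_mul_two_pi, div_one, ← nsmul_eq_mul, Circle.exp_nsmul]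
  have hzero : k * t - j * (2 * Real.pi) = 0 := by
    refine hsmall _ ?_ ?_
    · have h1 : k * t - j * (2 * Real.pi) = (k * (t / (2 * Real.pi)) - j) * (2 * Real.pi) := by
        field_simp
      rw [h1, abs_mul, abs_of_pos Real.two_pi_pos]
      calc _ ≤ 1 / ((N : ℝ) + 1) * (2 * Real.pi) := by gcongr
        _ < δ := by
          rw [div_lt_iff₀ hδ] at hN
          rw [one_div, inv_mul_lt_iff₀ (by positivity)]
          linarith
    · rw [hexp]
      exact (MulAction.stabilizer Circle y).pow_mem (x := Circle.exp t) hs k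
  rw [hzero, Circle.exp_zero] at hexp
  obtain ⟨c, hc⟩ := Nat.dvd_factorial hk hkN
  rw [hc, pow_mul, ← hexp, one_pow]

/-- The fixed-point set of a nontrivial smooth circle action on a connected manifold has empty
interior. -/
theorem Circle.interior_fixedPoints_eq_empty (E : Type*) [NormedAddCommGroup E]
    [NormedSpace ℝ E] [ChartedSpace E M] [IsManifold 𝓘(ℝ, E) ∞ M] [T2Space M]
    [ContMDiffSMul (𝓡 1) 𝓘(ℝ, E) ∞ Circle M] [PreconnectedSpace M]
    (h : ∃ (g : Circle) (x : M), g • x ≠ x) : interior (MulAction.fixedPoints Circle M) = ∅ := by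
  have : ContinuousSMul Circle M :=
    ContMDiffSMul.continuousSMul (I := 𝓡 1) (I' := 𝓘(ℝ, E)) ∞
  have : IsManifold 𝓘(ℝ, E) 1 M := .of_le (n := ∞) (by norm_num)
  by_contra hne
  obtain ⟨g, x, hgx⟩ := h
  refine hgx (Circle.smul_eq_self_of_forall_isOfFinOrder (fun g hg x => ?_) g x)
  obtain ⟨n, hn, hgn⟩ := isOfFinOrder_iff_pow_eq_one.1 hg
  have hsmooth : ContMDiff 𝓘(ℝ, E) 𝓘(ℝ, E) 1 (fun y : M => g • y) :=
    (ContMDiffSMul.contMDiff_const_smul (I := 𝓡 1) (I' := 𝓘(ℝ, E)) (n := ∞) g).of_le (by norm_num)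
  refine hsmooth.eq_self_of_interior_fixedPoints_nonempty hn (fun y => ?_) ?_ x
  · rw [smul_iterate_apply, hgn, one_smul]
  · exact (Set.nonempty_iff_ne_empty.2 hne).mono (interior_mono
      fun y (hy : y ∈ MulAction.fixedPoints Circle M) => MulAction.mem_fixedPoints.1 hy g)

/-- A smooth circle-valued map whose values fix the points they are attached to is constant. -/
theorem Circle.eq_of_forall_smul_eq_self {E : Type*} [NormedAddCommGroup E] [NormedSpace ℝ E]
    [ChartedSpace E M] [IsManifold 𝓘(ℝ, E) ∞ M] [T2Space M]
    [ContMDiffSMul (𝓡 1) 𝓘(ℝ, E) ∞ Circle M] [PreconnectedSpace M]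
    (h : ∃ (g : Circle) (x : M), g • x ≠ x) {α : M → Circle}
    (hα : ContMDiff 𝓘(ℝ, E) (𝓡 1) ∞ α) (hfix : ∀ x, α x • x = x) (x y : M) : α x = α y := by
  have : ContinuousSMul Circle M :=
    ContMDiffSMul.continuousSMul (I := 𝓡 1) (I' := 𝓘(ℝ, E)) ∞
  have : IsManifold 𝓘(ℝ, E) 1 M := .of_le (n := ∞) (by norm_num)
  have hcoe : ContMDiff 𝓘(ℝ, E) 𝓘(ℝ, ℂ) 1 (fun x => (α x : ℂ)) :=
    haveI := finrank_real_complex_fact'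
    contMDiff_coe_sphere.comp (hα.of_le (by norm_num))
  have hdense : Dense (MulAction.fixedPoints Circle M)ᶜ :=
    interior_eq_empty_iff_dense_compl.1 (Circle.interior_fixedPoints_eq_empty E h)
  have hloc : IsLocallyConstant (fun x => (α x : ℂ)) := by
    refine hcoe.isLocallyConstant_of_dense hdense fun x hx => ?_
    obtain ⟨g, hg⟩ : ∃ g : Circle, g • x ≠ x := by
      simpa [MulAction.mem_fixedPoints] using hx
    obtain ⟨m, hm, hev⟩ := Circle.exists_pow_eq_one_of_smul_ne hg
    -- The `m`-th roots of unity are finite in number, so near `x` the map `α` avoids all of them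
    -- but `α x`.
    have hopen : ((({z : Circle | z ^ m = 1} \ {α x}) : Set Circle))ᶜ ∈ 𝓝 (α x) :=
      ((Circle.finite_setOf_pow_eq_one hm).subset Set.sdiff_subset).isClosed.isOpen_compl.mem_nhds
        (by simp)
    filter_upwards [hev, hα.continuous.continuousAt hopen] with y hy hy'
    have hmem : α y ^ m = 1 := hy _ (hfix y)
    by_contra hne
    exact hy' ⟨hmem, fun h => hne (congrArg _ h)⟩
  exact Circle.coe_injective
    (hloc.apply_eq_of_isPreconnected isPreconnected_univ (Set.mem_univ x) (Set.mem_univ y))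

end CircleAction

theorem theorem1p2 {E : Type*} [NormedAddCommGroup E] [NormedSpace ℝ E] [FiniteDimensional ℝ E]
    {M : Type*} [TopologicalSpace M] [T2Space M] [ConnectedSpace M]
    [ChartedSpace E M] [IsManifold 𝓘(ℝ, E) ∞ M]
    [MulAction Circle M] [ContMDiffSMul (𝓡 1) 𝓘(ℝ, E) ∞ Circle M]
    (hnontrivial : ∃ (g : Circle) (x : M), g • x ≠ x) :
    interior (MulAction.fixedPoints Circle M) = ∅ ∧
    (∀ α : C^∞⟮𝓘(ℝ, E), M; 𝓡 1, Circle⟯,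
      α ∈ LieAction.Zid (𝓡 1) 𝓘(ℝ, E) Circle M ↔
        ∃ k ∈ LieAction.ineffectivityKernel (𝓡 1) 𝓘(ℝ, E) Circle M, ∀ x : M, α x = k) ∧
    (∃ e : LieAction.Zid (𝓡 1) 𝓘(ℝ, E) Circle M ≃*
          LieAction.ineffectivityKernel (𝓡 1) 𝓘(ℝ, E) Circle M,
      ∀ (α : LieAction.Zid (𝓡 1) 𝓘(ℝ, E) Circle M) (x : M),
        (α : C^∞⟮𝓘(ℝ, E), M; 𝓡 1, Circle⟯) x = (e α : Circle)) ∧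
    Finite (LieAction.ineffectivityKernel (𝓡 1) 𝓘(ℝ, E) Circle M) ∧
    IsCyclic (LieAction.ineffectivityKernel (𝓡 1) 𝓘(ℝ, E) Circle M) ∧
    Finite (LieAction.Zid (𝓡 1) 𝓘(ℝ, E) Circle M) ∧
    IsCyclic (LieAction.Zid (𝓡 1) 𝓘(ℝ, E) Circle M) := by
  have : ContinuousSMul Circle M :=
    ContMDiffSMul.continuousSMul (I := 𝓡 1) (I' := 𝓘(ℝ, E)) ∞
  have hconst : ∀ α ∈ LieAction.Zid (𝓡 1) 𝓘(ℝ, E) Circle M, ∀ x y : M, α x = α y :=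
    fun α hα => Circle.eq_of_forall_smul_eq_self hnontrivial α.contMDiff
      ((LieAction.mem_Zid_iff (𝓡 1) 𝓘(ℝ, E) Circle M α).1 hα)
  have hmem : ∀ α ∈ LieAction.Zid (𝓡 1) 𝓘(ℝ, E) Circle M, ∀ x : M,
      α x ∈ LieAction.ineffectivityKernel (𝓡 1) 𝓘(ℝ, E) Circle M := by
    intro α hα x
    rw [LieAction.mem_ineffectivityKernel_iff]
    intro y
    rw [hconst α hα x y]
    exact (LieAction.mem_Zid_iff (𝓡 1) 𝓘(ℝ, E) Circle M α).1 hα y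
  have hiff : ∀ α : C^∞⟮𝓘(ℝ, E), M; 𝓡 1, Circle⟯,
      α ∈ LieAction.Zid (𝓡 1) 𝓘(ℝ, E) Circle M ↔
        ∃ k ∈ LieAction.ineffectivityKernel (𝓡 1) 𝓘(ℝ, E) Circle M, ∀ x : M, α x = k := by
    refine fun α => ⟨fun hα => ?_, ?_⟩
    · obtain ⟨x₀⟩ := (inferInstance : Nonempty M)
      exact ⟨α x₀, hmem α hα x₀, fun x => hconst α hα x x₀⟩
    · rintro ⟨k, hk, hαk⟩
      rw [LieAction.mem_Zid_iff]
      intro x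
      rw [hαk x]
      exact (LieAction.mem_ineffectivityKernel_iff (𝓡 1) 𝓘(ℝ, E) Circle M k).1 hk x
  have hfin : Finite (LieAction.ineffectivityKernel (𝓡 1) 𝓘(ℝ, E) Circle M) := by
    obtain ⟨g, x, hgx⟩ := hnontrivial
    obtain ⟨m, hm, hev⟩ := Circle.exists_pow_eq_one_of_smul_ne hgx
    exact ((Circle.finite_setOf_pow_eq_one hm).subset fun k hk => hev.self_of_nhds k
      ((LieAction.mem_ineffectivityKernel_iff (𝓡 1) 𝓘(ℝ, E) Circle M k).1 hk x)).to_subtype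
  -- A finite group embedding in the multiplicative monoid of the field `ℂ` is cyclic.
  have hcyc : IsCyclic (LieAction.ineffectivityKernel (𝓡 1) 𝓘(ℝ, E) Circle M) :=
    isCyclic_of_injective_ringHom
      (Circle.coeHom.comp (LieAction.ineffectivityKernel (𝓡 1) 𝓘(ℝ, E) Circle M).subtype)
      (Circle.coe_injective.comp Subtype.coe_injective)
  obtain ⟨x₀⟩ := (inferInstance : Nonempty M)
  let e : LieAction.Zid (𝓡 1) 𝓘(ℝ, E) Circle M ≃*
      LieAction.ineffectivityKernel (𝓡 1) 𝓘(ℝ, E) Circle M :=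
    { toFun := fun α => ⟨α.1 x₀, hmem α.1 α.2 x₀⟩
      invFun := fun k => ⟨⟨fun _ => k.1, contMDiff_const⟩, (hiff _).2 ⟨k.1, k.2, fun _ => rfl⟩⟩
      left_inv := fun α => Subtype.ext (ContMDiffMap.ext fun x => hconst α.1 α.2 x₀ x)
      right_inv := fun _ => rfl
      map_mul' := fun _ _ => rfl }
  exact ⟨Circle.interior_fixedPoints_eq_empty E hnontrivial, hiff,
    ⟨e, fun α x => hconst α.1 α.2 x x₀⟩, hfin, hcyc, .of_equiv _ e.symm.toEquiv,
    isCyclic_of_surjective e.symm e.symm.surjective⟩
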